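/- For an $n\times p$ real matrix $X$ let $\|X\|_F$ be its Frobenius norm, $\|X\|$ its spectral norm and $\mathrm{sr}(X)=\|X\|_F^2/\|X\|^2$ its stable rank (with $\mathrm{sr}(0)=0$). For a $p\times d$ matrix $R$ and $\ell\in\mathbb{N}$, let $R^{(\ell)}$ be the $p\times\binom{d}{\ell}$ matrix whose column indexed by $1\le i_1<\dots<i_\ell\le d$ is the entrywise product of the columns $i_1,\dots,i_\ell$ of $R$. **Theorem.** There are absolute constants $C,c>0$ such that the following holds. Let $\ell\ge 3$ be an integer, let $X$ be a fixed real $n\times p$ matrix, and let $R$ be a $p\times d$ random matrix with independent entries satisfying $\mathbb{E}[R_{ij}]=0$, $\mathbb{E}[R_{ij}^2]=1$ and $|R_{ij}|\le\tau$ almost surely. Let $\epsilon\in(0,1)$ and let $k$ be an integer with $1\le k\le\binom{d}{\ell}$ such that $$\mathrm{sr}(X)\;\ge\;\frac{C\,\tau^{4\ell}k^3}{\epsilon^2}\log\left(\frac{d^\ell}{k}\right).$$ Then with probability at least $1-\exp\left(-c\,\epsilon^2\,\mathrm{sr}(X)/(k^2\tau^{4\ell})\right)$ the matrix $XR^{(\ell)}$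 satisfies the $(k,\epsilon)$-restricted isometry property: for every $u\in\mathbb{R}^{\binom{d}{\ell}}$ with Euclidean norm $\|u\|=1$ and at most $k$ nonzero coordinates, $$(1-\epsilon)\|X\|_F\;\le\;\|XR^{(\ell)}u\|\;\le\;(1+\epsilon)\|X\|_F .$$ -/

import Mathlib

open MeasureTheory ProbabilityTheory

noncomputable section

open scoped Matrix.Norms.Frobenius in
/-- The Frobenius norm of a real matrix. -/
def frobeniusNorm {m n : Type*} [Fintype m] [Fintype n] (A : Matrix m n ℝ) : ℝ := ‖A‖

open scoped Matrix.Norms.L2Operator in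
/-- The spectral norm of a real matrix: its operator norm as a map between Euclidean spaces. -/
def matrixSpectralNorm {m n : Type*} [Fintype m] [Fintype n] [DecidableEq n]
    (A : Matrix m n ℝ) : ℝ := ‖A‖

/-- The stable rank `‖A‖_F² / ‖A‖²` (equal to `0` for the zero matrix). -/
def stableRank {m n : Type*} [Fintype m] [Fintype n] [DecidableEq n]
    (A : Matrix m n ℝ) : ℝ :=
  frobeniusNorm A ^ 2 / matrixSpectralNorm A ^ 2

/-- The `ℓ`-way column Hadamard product of a `p × d` matrix. A column index
`i₁ < i₂ < ⋯ < i_ℓ` is encoded as the `ℓ`-element set `{i₁, …, i_ℓ}`, and the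
corresponding column is the entrywise product of the columns `i₁, …, i_ℓ` of `M`. -/
def columnHadamard {p d : ℕ} (ℓ : ℕ) (M : Matrix (Fin p) (Fin d) ℝ) :
    Matrix (Fin p) {s : Finset (Fin d) // s.card = ℓ} ℝ :=
  Matrix.of fun r s => ∏ i ∈ s.1, M r i

/-- The `(k, ε)` restricted isometry property of a factored matrix `X * A`, with the scaling
`‖X‖_F`: every unit vector `u` with at most `k` nonzero coordinates satisfies
`(1 - ε) ‖X‖_F ≤ ‖X A u‖ ≤ (1 + ε) ‖X‖_F` in Euclidean norms. -/
def SatisfiesRIP {m n ι : Type*} [Fintype m] [Fintype n] [Fintype ι]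
    (X : Matrix m n ℝ) (A : Matrix n ι ℝ) (k : ℕ) (ε : ℝ) : Prop :=
  ∀ u : EuclideanSpace ℝ ι, ‖u‖ = 1 → {i | u i ≠ 0}.ncard ≤ k →
    (1 - ε) * frobeniusNorm X ≤ ‖WithLp.toLp 2 ((X * A).mulVec u.ofLp)‖ ∧
      ‖WithLp.toLp 2 ((X * A).mulVec u.ofLp)‖ ≤ (1 + ε) * frobeniusNorm X

end

/-! Put `Z = X R^(ℓ)`. For a k-sparse unit vector the ℓ¹ norm is at most `√k`, so the restricted
isometry property follows once every entry of `Zᵀ Z` is within `(ε/k)‖X‖_F²` of the matching entry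
of `‖X‖_F² · 1` (`abs_quadratic_sub_le_of_gram_entries`). No net over sparse vectors is needed. By
polarization, the entries are controlled by `‖Z u‖²` for the `2N²` choices of `u` among `e_s` and
`(e_s ± e_t)/√2`, where `N = d.choose ℓ`.

For such a fixed `u`, the coordinates of `y = R^(ℓ) u` come from different rows of `R`, so they are
independent; distinct column products are orthonormal, so they are centred with variance 1; and `u`
has ℓ¹ norm at most `√2`, so they are bounded by `K = √2 τ^ℓ`. A Hanson–Wright bound
(`measureReal_quadratic_deviation_le`) then gives failure probability at most `4 exp(-Q/1024)` with
`Q = ε² sr(X)/(k² τ^(4ℓ))`. The hypothesis on the stable rank makes `Q` large against `log d^ℓ`,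
which pays for the union bound.

Hanson–Wright splits `‖X y‖²` into its diagonal, a sum of independent bounded variables, and its
off-diagonal part, which is decoupled over random index subsets and then handled by Gaussian
linearisation (`lintegral_exp_quadratic_le`). -/

/-! ### Exponential moments of quadratic forms -/

open Matrix in
theorem exists_orthogonal_diagonalization {κ ι : Type*} [Fintype κ] [Fintype ι] [DecidableEq ι]
    (Y : Matrix κ ι ℝ) :
    ∃ (U : Matrix ι ι ℝ) (s : ι → ℝ), Uᵀ * U = 1 ∧ U * diagonal s * Uᵀ = Yᵀ * Y := by
  have h : (Yᵀ * Y).IsHermitian := by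
    simpa [Matrix.conjTranspose_eq_transpose_of_trivial] using isHermitian_conjTranspose_mul_self Y
  refine ⟨h.eigenvectorUnitary, h.eigenvalues, ?_, ?_⟩
  · have := (Matrix.mem_unitaryGroup_iff' (A := (h.eigenvectorUnitary : Matrix ι ι ℝ))).1
      h.eigenvectorUnitary.2
    simpa [star_eq_conjTranspose, Matrix.conjTranspose_eq_transpose_of_trivial] using this
  · have := h.spectral_theorem
    rw [Unitary.conjStarAlgAut_apply] at this
    simpa [star_eq_conjTranspose, Matrix.conjTranspose_eq_transpose_of_trivial, Function.comp_def]
      using this.symm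

theorem lintegral_exp_mul_gaussianReal (a : ℝ) :
    ∫⁻ g, ENNReal.ofReal (Real.exp (a * g)) ∂gaussianReal 0 1
      = ENNReal.ofReal (Real.exp (a ^ 2 / 2)) := by
  have h := congrFun (mgf_id_gaussianReal (μ := 0) (v := 1)) a
  rw [← ofReal_integral_eq_lintegral_ofReal]
  · congr 1
    simpa [mgf] using h
  · exact integrable_exp_mul_gaussianReal a
  · exact ae_of_all _ fun _ => (Real.exp_pos _).le

/-- The integral equals `(1 - s)^(-1/2)`, and `1 ≤ (1 - s) e^(2s)` on `[0, 1/2]`. -/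
theorem lintegral_exp_sq_gaussianReal_le {s : ℝ} (hs0 : 0 ≤ s) (hs : s ≤ 1 / 2) :
    ∫⁻ g, ENNReal.ofReal (Real.exp (s / 2 * g ^ 2)) ∂gaussianReal 0 1
      ≤ ENNReal.ofReal (Real.exp s) := by
  have hpos : 0 < (1 - s) / 2 := by linarith
  have key : ∀ g : ℝ, gaussianPDFReal 0 1 g * Real.exp (s / 2 * g ^ 2)
      = (√(2 * Real.pi))⁻¹ * Real.exp (-((1 - s) / 2) * g ^ 2) := by
    intro g
    simp only [gaussianPDFReal, NNReal.coe_one, mul_one, sub_zero]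
    rw [mul_assoc, ← Real.exp_add]
    congr 2
    ring
  rw [gaussianReal_of_var_ne_zero 0 one_ne_zero,
    lintegral_withDensity_eq_lintegral_mul _ (measurable_gaussianPDF 0 1) (by fun_prop)]
  have e : ∀ g : ℝ, (gaussianPDF 0 1 * fun g => ENNReal.ofReal (Real.exp (s / 2 * g ^ 2))) g
      = ENNReal.ofReal ((√(2 * Real.pi))⁻¹ * Real.exp (-((1 - s) / 2) * g ^ 2)) := by
    intro g
    rw [Pi.mul_apply, gaussianPDF, ← ENNReal.ofReal_mul (gaussianPDFReal_nonneg _ _ _), key]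
  simp_rw [e]
  rw [← ofReal_integral_eq_lintegral_ofReal
    ((integrable_exp_neg_mul_sq hpos).const_mul _) (ae_of_all _ fun g => by positivity)]
  apply ENNReal.ofReal_le_ofReal
  rw [integral_const_mul, integral_gaussian, ← Real.sqrt_inv, ← Real.sqrt_mul (by positivity)]
  rw [Real.sqrt_le_left (Real.exp_pos _).le]
  have h1 : (2 * Real.pi)⁻¹ * (Real.pi / ((1 - s) / 2)) = (1 - s)⁻¹ := by
    have := Real.pi_pos.ne'
    have : 1 - s ≠ 0 := by linarith
    field_simp
  rw [h1, inv_le_iff_one_le_mul₀ (by linarith), ← Real.exp_nat_mul]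
  have h2 := Real.quadratic_le_exp_of_nonneg (x := ((2 : ℕ) : ℝ) * s) (by positivity)
  push_cast at h2 ⊢
  nlinarith [mul_le_mul_of_nonneg_right h2 (by linarith : 0 ≤ 1 - s), mul_nonneg hs0 hs0,
    mul_nonneg hs0 (by linarith : 0 ≤ 1 - 2 * s)]

theorem lintegral_exp_sum_mul_le {Ω ι : Type*} [Fintype ι] [MeasurableSpace Ω] {μ : Measure Ω}
    [IsProbabilityMeasure μ] {y : ι → Ω → ℝ} {K : ℝ}
    (hind : iIndepFun y μ) (hsub : ∀ i, HasSubgaussianMGF (y i) (Real.toNNReal (K ^ 2)) μ)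
    (c : ι → ℝ) :
    ∫⁻ ω, ENNReal.ofReal (Real.exp (∑ i, c i * y i ω)) ∂μ
      ≤ ENNReal.ofReal (Real.exp (K ^ 2 / 2 * ∑ i, c i ^ 2)) := by
  have h1 : iIndepFun (fun i ω => c i * y i ω) μ :=
    hind.comp (fun i x => c i * x) fun i => measurable_const_mul _
  have h2 := HasSubgaussianMGF.sum_of_iIndepFun h1 (s := Finset.univ)
    (fun i _ => (hsub i).const_mul (c i))
  have h3 := h2.mgf_le 1
  have h4 := h2.integrable_exp_mul 1
  simp only [one_mul, mgf] at h3 h4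
  rw [← ofReal_integral_eq_lintegral_ofReal h4 (ae_of_all _ fun _ => (Real.exp_pos _).le)]
  refine ENNReal.ofReal_le_ofReal (h3.trans (le_of_eq ?_))
  congr 1
  rw [NNReal.coe_sum, one_pow, mul_one, Finset.mul_sum, Finset.sum_div]
  refine Finset.sum_congr rfl fun i _ => ?_
  change c i ^ 2 * ((Real.toNNReal (K ^ 2) : NNReal) : ℝ) / 2 = _
  rw [Real.coe_toNNReal _ (sq_nonneg K)]
  ring

open Matrix in
-- Linearise the square: `exp(β‖Yv‖²/2)` is the mean of `exp⟨U √(βs) g, v⟩` over a standard Gaussian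
-- `g`, where `U`, `s` diagonalise `Yᵀ Y`. After Tonelli, `hlin` bounds the mean over `y`, and the
-- remaining Gaussian integral factors over the eigenvalues. Only subgaussianity of linear forms is
-- used, not independence of the coordinates.
theorem lintegral_exp_quadratic_le {Ω ι κ : Type*} [Fintype ι] [Fintype κ] [DecidableEq ι]
    [MeasurableSpace Ω] {μ : Measure Ω} [IsProbabilityMeasure μ] {y : ι → Ω → ℝ} {K : ℝ}
    (hy : ∀ i, Measurable (y i))
    (hlin : ∀ c : ι → ℝ, ∫⁻ ω, ENNReal.ofReal (Real.exp (∑ i, c i * y i ω)) ∂μ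
      ≤ ENNReal.ofReal (Real.exp (K ^ 2 / 2 * ∑ i, c i ^ 2)))
    (Y : Matrix κ ι ℝ) {B : ℝ} (hB : ∀ v, (Y *ᵥ v) ⬝ᵥ (Y *ᵥ v) ≤ B ^ 2 * (v ⬝ᵥ v))
    {β : ℝ} (hβ : 0 ≤ β) (hβB : K ^ 2 * β * B ^ 2 ≤ 1 / 2) :
    ∫⁻ ω, ENNReal.ofReal (Real.exp (β / 2 * ((Y *ᵥ fun i => y i ω) ⬝ᵥ (Y *ᵥ fun i => y i ω)))) ∂μ
      ≤ ENNReal.ofReal (Real.exp (K ^ 2 * β * (Yᵀ * Y).trace)) := by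
  obtain ⟨U, s, hU, hs⟩ := exists_orthogonal_diagonalization Y
  have hquad : ∀ v, (Y *ᵥ v) ⬝ᵥ (Y *ᵥ v) = ∑ r, s r * (Uᵀ *ᵥ v) r ^ 2 := by
    intro v
    rw [dotProduct_mulVec, vecMul_mulVec, ← hs, ← vecMul_vecMul, ← vecMul_vecMul,
      ← dotProduct_mulVec, ← mulVec_transpose U, dotProduct]
    refine Finset.sum_congr rfl fun r _ => ?_
    rw [vecMul_diagonal]
    ring
  -- Test the quadratic form on the unit eigenvectors `U e_r`.
  have hs0 : ∀ r, 0 ≤ s r ∧ s r ≤ B ^ 2 := by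
    intro r
    have e1 : Uᵀ *ᵥ (U *ᵥ Pi.single r 1) = Pi.single r 1 := by
      rw [mulVec_mulVec, hU, one_mulVec]
    have e2 : (U *ᵥ Pi.single r 1) ⬝ᵥ (U *ᵥ Pi.single r 1) = 1 := by
      rw [dotProduct_mulVec, vecMul_mulVec, hU]
      simp
    have e3 := hquad (U *ᵥ Pi.single r 1)
    rw [e1] at e3
    have e4 : ∑ x, s x * (Pi.single r 1 : ι → ℝ) x ^ 2 = s r := by
      rw [Finset.sum_eq_single r] <;> simp +contextual
    rw [e4] at e3
    have e5 := hB (U *ᵥ Pi.single r 1)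
    rw [e2, e3, mul_one] at e5
    refine ⟨?_, e5⟩
    rw [← e3]
    exact Finset.sum_nonneg fun i _ => mul_self_nonneg _
  have htr : (Yᵀ * Y).trace = ∑ r, s r := by
    rw [← hs, Matrix.trace_mul_comm, ← Matrix.mul_assoc, hU, Matrix.one_mul, trace_diagonal]
  have hlinG : ∀ v : ι → ℝ, ENNReal.ofReal (Real.exp (β / 2 * ((Y *ᵥ v) ⬝ᵥ (Y *ᵥ v))))
      = ∫⁻ g, ENNReal.ofReal (Real.exp (∑ i, (U *ᵥ fun r => √(β * s r) * g r) i * v i))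
        ∂(Measure.pi fun _ : ι => gaussianReal 0 1) := by
    intro v
    have e : ∀ g : ι → ℝ, ENNReal.ofReal (Real.exp (∑ i, (U *ᵥ fun r => √(β * s r) * g r) i * v i))
        = ∏ r, ENNReal.ofReal (Real.exp ((√(β * s r) * (Uᵀ *ᵥ v) r) * g r)) := by
      intro g
      rw [← ENNReal.ofReal_prod_of_nonneg (fun _ _ => (Real.exp_pos _).le), ← Real.exp_sum]
      congr 2
      change (U *ᵥ fun r => √(β * s r) * g r) ⬝ᵥ v = _
      rw [dotProduct_comm, dotProduct_mulVec, ← mulVec_transpose, dotProduct]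
      exact Finset.sum_congr rfl fun i _ => by ring
    simp_rw [e]
    rw [lintegral_prod_eq_prod_lintegral_of_indepFun Finset.univ
      (fun r (g : ι → ℝ) => ENNReal.ofReal (Real.exp ((√(β * s r) * (Uᵀ *ᵥ v) r) * g r)))
      (iIndepFun_pi (X := fun r (x : ℝ) =>
        ENNReal.ofReal (Real.exp ((√(β * s r) * (Uᵀ *ᵥ v) r) * x))) fun i => by fun_prop)
        fun i => by fun_prop]
    have e2 : ∀ r, ∫⁻ g : ι → ℝ, ENNReal.ofReal (Real.exp ((√(β * s r) * (Uᵀ *ᵥ v) r) * g r))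
        ∂(Measure.pi fun _ : ι => gaussianReal 0 1)
        = ENNReal.ofReal (Real.exp (β / 2 * (s r * (Uᵀ *ᵥ v) r ^ 2))) := by
      intro r
      rw [(measurePreserving_eval (fun _ : ι => gaussianReal 0 1) r).lintegral_comp
        (f := fun x => ENNReal.ofReal (Real.exp ((√(β * s r) * (Uᵀ *ᵥ v) r) * x))) (by fun_prop),
        lintegral_exp_mul_gaussianReal, mul_pow, Real.sq_sqrt (mul_nonneg hβ (hs0 r).1)]
      congr 2
      ring
    simp_rw [e2]
    rw [← ENNReal.ofReal_prod_of_nonneg (fun _ _ => (Real.exp_pos _).le), ← Real.exp_sum,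
      ← Finset.mul_sum, hquad]
  simp_rw [hlinG]
  rw [lintegral_lintegral_swap]
  swap
  · refine Measurable.aemeasurable ?_
    simp only [Function.uncurry_def, mulVec, dotProduct]
    fun_prop
  refine (lintegral_mono fun g => hlin _).trans ?_
  have e : ∀ g : ι → ℝ, ENNReal.ofReal (Real.exp (K ^ 2 / 2 *
      ∑ i, (U *ᵥ fun r => √(β * s r) * g r) i ^ 2))
      = ∏ r, ENNReal.ofReal (Real.exp ((K ^ 2 * β * s r) / 2 * g r ^ 2)) := by
    intro g
    rw [← ENNReal.ofReal_prod_of_nonneg (fun _ _ => (Real.exp_pos _).le), ← Real.exp_sum]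
    congr 2
    have : ∀ w : ι → ℝ, ∑ i, (U *ᵥ w) i ^ 2 = ∑ i, w i ^ 2 := by
      intro w
      have : (U *ᵥ w) ⬝ᵥ (U *ᵥ w) = w ⬝ᵥ w := by
        rw [dotProduct_mulVec, vecMul_mulVec, hU, ← dotProduct_mulVec, one_mulVec]
      simpa [dotProduct, sq] using this
    rw [this, Finset.mul_sum]
    refine Finset.sum_congr rfl fun r _ => ?_
    rw [mul_pow, Real.sq_sqrt (mul_nonneg hβ (hs0 r).1)]
    ring
  simp_rw [e]
  rw [lintegral_prod_eq_prod_lintegral_of_indepFun Finset.univ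
    (fun r (g : ι → ℝ) => ENNReal.ofReal (Real.exp ((K ^ 2 * β * s r) / 2 * g r ^ 2)))
    (iIndepFun_pi (X := fun r (x : ℝ) =>
      ENNReal.ofReal (Real.exp ((K ^ 2 * β * s r) / 2 * x ^ 2))) fun i => by fun_prop)
      fun i => by fun_prop]
  rw [htr, Finset.mul_sum, Real.exp_sum,
    ENNReal.ofReal_prod_of_nonneg (fun _ _ => (Real.exp_pos _).le)]
  refine Finset.prod_le_prod' fun r _ => ?_
  rw [(measurePreserving_eval (fun _ : ι => gaussianReal 0 1) r).lintegral_comp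
    (f := fun x => ENNReal.ofReal (Real.exp ((K ^ 2 * β * s r) / 2 * x ^ 2))) (by fun_prop)]
  refine lintegral_exp_sq_gaussianReal_le (by have := (hs0 r).1; positivity) (le_trans ?_ hβB)
  exact mul_le_mul_of_nonneg_left (hs0 r).2 (by positivity)

/-! ### Decoupling the off-diagonal part -/

theorem IndepFun.lintegral_comp_prodMk {Ω β γ : Type*} [MeasurableSpace Ω] [MeasurableSpace β]
    [MeasurableSpace γ] {μ : Measure Ω} [IsProbabilityMeasure μ] {U : Ω → β} {V : Ω → γ}
    (hU : Measurable U) (hV : Measurable V) (h : IndepFun U V μ) {f : β × γ → ENNReal}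
    (hf : Measurable f) :
    ∫⁻ ω, f (U ω, V ω) ∂μ = ∫⁻ ω', ∫⁻ ω, f (U ω, V ω') ∂μ ∂μ := by
  have := Measure.isProbabilityMeasure_map (μ := μ) hU.aemeasurable
  have := Measure.isProbabilityMeasure_map (μ := μ) hV.aemeasurable
  rw [← lintegral_map (f := f) hf (hU.prodMk hV),
    (indepFun_iff_map_prod_eq_prod_map_map hU.aemeasurable hV.aemeasurable).1 h,
    lintegral_prod_symm' _ hf, lintegral_map _ hV]
  · exact lintegral_congr fun ω => lintegral_map (by fun_prop) hU
  · exact hf.lintegral_prod_left'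

theorem iIndepFun.indepFun_ite_mem {Ω ι : Type*} [Fintype ι] [DecidableEq ι] [MeasurableSpace Ω]
    {μ : Measure Ω} {y : ι → Ω → ℝ} (hind : iIndepFun y μ) (hy : ∀ i, Measurable (y i))
    (I : Finset ι) :
    IndepFun (fun ω i => if i ∈ I then y i ω else 0) (fun ω i => if i ∈ I then 0 else y i ω) μ := by
  have h := hind.indepFun_finset I Iᶜ disjoint_compl_right hy
  let φ : (I → ℝ) → ι → ℝ := fun u i => if hi : i ∈ I then u ⟨i, hi⟩ else 0
  let ψ : ((Iᶜ : Finset ι) → ℝ) → ι → ℝ := fun u i =>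
    if hi : i ∈ Iᶜ then u ⟨i, hi⟩ else 0
  have hφ : Measurable φ := by
    refine measurable_pi_lambda _ fun i => ?_
    by_cases hi : i ∈ I <;> simp only [φ, hi, dite_true, dite_false] <;> fun_prop
  have hψ : Measurable ψ := by
    refine measurable_pi_lambda _ fun i => ?_
    by_cases hi : i ∈ Iᶜ <;> simp only [ψ, hi, dite_true, dite_false] <;> fun_prop
  convert h.comp hφ hψ using 1
  · ext ω i
    by_cases hi : i ∈ I <;> simp [φ, hi]
  · ext ω i
    by_cases hi : i ∈ I <;> simp [ψ, hi]

open Matrix in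
-- With the coordinates outside `I` frozen, the exponent is a linear form in those inside `I`;
-- integrating these out leaves the exponential of a quadratic form in the frozen ones.
theorem lintegral_exp_bilinear_split_le {Ω ι κ : Type*} [Fintype ι] [Fintype κ] [DecidableEq ι]
    [MeasurableSpace Ω] {μ : Measure Ω} [IsProbabilityMeasure μ] {y : ι → Ω → ℝ} {K : ℝ}
    (hy : ∀ i, Measurable (y i)) (hind : iIndepFun y μ)
    (hsub : ∀ i, HasSubgaussianMGF (y i) (Real.toNNReal (K ^ 2)) μ)
    (X : Matrix κ ι ℝ) {B : ℝ} (hB : ∀ v, (X *ᵥ v) ⬝ᵥ (X *ᵥ v) ≤ B ^ 2 * (v ⬝ᵥ v))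
    (hBT : ∀ w, (Xᵀ *ᵥ w) ⬝ᵥ (Xᵀ *ᵥ w) ≤ B ^ 2 * (w ⬝ᵥ w))
    {a : ℝ} (ha : K ^ 4 * a ^ 2 * B ^ 4 ≤ 1 / 2) (I : Finset ι) :
    ∫⁻ ω, ENNReal.ofReal (Real.exp (a * ((X *ᵥ fun i => if i ∈ I then y i ω else 0) ⬝ᵥ
      (X *ᵥ fun i => if i ∈ I then 0 else y i ω)))) ∂μ
      ≤ ENNReal.ofReal (Real.exp (K ^ 4 * a ^ 2 * B ^ 2 * (Xᵀ * X).trace)) := by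
  have hlin := lintegral_exp_sum_mul_le hind hsub
  rw [IndepFun.lintegral_comp_prodMk (μ := μ)
    (U := fun ω i => if i ∈ I then y i ω else 0) (V := fun ω i => if i ∈ I then 0 else y i ω)
    (f := fun p => ENNReal.ofReal (Real.exp (a * ((X *ᵥ p.1) ⬝ᵥ (X *ᵥ p.2)))))
    (measurable_pi_lambda _ fun i => by by_cases hi : i ∈ I <;> simp [hi, hy])
    (measurable_pi_lambda _ fun i => by by_cases hi : i ∈ I <;> simp [hi, hy])
    (iIndepFun.indepFun_ite_mem hind hy I) (by simp only [mulVec, dotProduct]; fun_prop)]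
  -- Zeroing the columns in `I` moves the restriction from the vector to the matrix, so the
  -- quadratic bound applies to all of `y`.
  let Y : Matrix κ ι ℝ := Matrix.of fun k i => if i ∈ I then 0 else X k i
  have hYv : ∀ v : ι → ℝ, Y *ᵥ v = X *ᵥ fun i => if i ∈ I then 0 else v i := by
    intro v
    ext k
    simp only [mulVec, dotProduct, Y, Matrix.of_apply]
    exact Finset.sum_congr rfl fun i _ => by split_ifs <;> simp
  have hYB : ∀ v, (Y *ᵥ v) ⬝ᵥ (Y *ᵥ v) ≤ B ^ 2 * (v ⬝ᵥ v) := by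
    intro v
    rw [hYv]
    refine (hB _).trans (mul_le_mul_of_nonneg_left ?_ (sq_nonneg B))
    refine Finset.sum_le_sum fun i _ => ?_
    dsimp only
    split_ifs
    · simpa using mul_self_nonneg (v i)
    · exact le_rfl
  have hYtr : (Yᵀ * Y).trace ≤ (Xᵀ * X).trace := by
    simp only [Matrix.trace, Matrix.diag_apply, Matrix.mul_apply, Matrix.transpose_apply, Y,
      Matrix.of_apply]
    refine Finset.sum_le_sum fun i _ => Finset.sum_le_sum fun k _ => ?_
    split_ifs
    · simpa using mul_self_nonneg (X k i)
    · exact le_rfl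
  have hinner : ∀ ω', ∫⁻ ω, ENNReal.ofReal (Real.exp (a *
      ((X *ᵥ fun i => if i ∈ I then y i ω else 0) ⬝ᵥ
      (X *ᵥ fun i => if i ∈ I then 0 else y i ω')))) ∂μ
      ≤ ENNReal.ofReal (Real.exp ((K ^ 2 * a ^ 2 * B ^ 2) / 2 *
        ((Y *ᵥ fun i => y i ω') ⬝ᵥ (Y *ᵥ fun i => y i ω')))) := by
    intro ω'
    set w := Y *ᵥ fun i => y i ω' with hw
    have e : ∀ ω, a * ((X *ᵥ fun i => if i ∈ I then y i ω else 0) ⬝ᵥ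
        (X *ᵥ fun i => if i ∈ I then 0 else y i ω'))
        = ∑ i, (if i ∈ I then a * (Xᵀ *ᵥ w) i else 0) * y i ω := by
      intro ω
      rw [← hYv (fun i => y i ω'), ← hw, dotProduct_comm, dotProduct_mulVec, ← mulVec_transpose,
        dotProduct, Finset.mul_sum]
      exact Finset.sum_congr rfl fun i _ => by split_ifs <;> ring
    simp_rw [e]
    refine (hlin _).trans (ENNReal.ofReal_le_ofReal (Real.exp_le_exp.2 ?_))
    have h1 : ∑ i, (if i ∈ I then a * (Xᵀ *ᵥ w) i else 0) ^ 2
        ≤ a ^ 2 * ((Xᵀ *ᵥ w) ⬝ᵥ (Xᵀ *ᵥ w)) := by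
      rw [dotProduct, Finset.mul_sum]
      refine Finset.sum_le_sum fun i _ => ?_
      split_ifs
      · exact le_of_eq (by ring)
      · rw [zero_pow two_ne_zero]
        exact mul_nonneg (sq_nonneg a) (mul_self_nonneg _)
    calc _ ≤ K ^ 2 / 2 * (a ^ 2 * (B ^ 2 * (w ⬝ᵥ w))) := by
          refine mul_le_mul_of_nonneg_left (h1.trans ?_) (by positivity)
          exact mul_le_mul_of_nonneg_left (hBT w) (sq_nonneg a)
      _ = _ := by ring
  refine (lintegral_mono hinner).trans ?_
  refine (lintegral_exp_quadratic_le hy hlin Y hYB (by positivity)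
    (by refine le_trans (le_of_eq ?_) ha; ring)).trans ?_
  refine ENNReal.ofReal_le_ofReal (Real.exp_le_exp.2 ?_)
  calc _ ≤ K ^ 2 * (K ^ 2 * a ^ 2 * B ^ 2) * (Xᵀ * X).trace :=
        mul_le_mul_of_nonneg_left hYtr (by positivity)
    _ = _ := by ring

/-- For `i ≠ j`, exactly a quarter of all subsets contain `i` and miss `j`. -/
theorem four_mul_sum_finset_separating {ι : Type*} [Fintype ι] [DecidableEq ι] (i j : ι) :
    4 * ∑ I : Finset ι, (if i ∈ I then (if j ∈ I then (0 : ℝ) else 1) else 0)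
      = if i = j then 0 else 2 ^ Fintype.card ι := by
  have e : ∀ I : Finset ι, (if i ∈ I then (if j ∈ I then (0 : ℝ) else 1) else 0)
      = if I ∈ Finset.Icc {i} {j}ᶜ then 1 else 0 := by
    intro I
    have : I ∈ Finset.Icc {i} ({j}ᶜ : Finset ι) ↔ i ∈ I ∧ j ∉ I := by
      rw [Finset.mem_Icc, Finset.singleton_subset_iff,
        Finset.subset_compl_comm, Finset.singleton_subset_iff, Finset.mem_compl]
    rw [if_congr this rfl rfl]
    split_ifs <;> simp_all
  simp_rw [e]
  rw [Finset.sum_ite_mem, Finset.univ_inter, Finset.sum_const, nsmul_eq_mul, mul_one]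
  split_ifs with h
  · subst h
    rw [Finset.Icc_eq_empty (by simp)]
    simp
  · have hc : 2 ≤ Fintype.card ι := by
      have := Finset.card_le_univ ({i, j} : Finset ι)
      rwa [Finset.card_pair h] at this
    rw [Finset.card_Icc_finset (by simpa using Ne.symm h), Finset.card_compl, Finset.card_singleton,
      Finset.card_singleton, Nat.sub_sub]
    obtain ⟨m, hm⟩ := Nat.exists_eq_add_of_le hc
    rw [hm]
    simp [pow_add]
    norm_num

open Matrix in
theorem offDiagonal_eq_average {ι κ : Type*} [Fintype ι] [Fintype κ] [DecidableEq ι]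
    (X : Matrix κ ι ℝ) (v : ι → ℝ) :
    (X *ᵥ v) ⬝ᵥ (X *ᵥ v) - ∑ i, (Xᵀ * X) i i * v i ^ 2
      = ∑ I : Finset ι, ((2 : ℝ) ^ Fintype.card ι)⁻¹ *
        (4 * ((X *ᵥ fun i => if i ∈ I then v i else 0) ⬝ᵥ
          (X *ᵥ fun i => if i ∈ I then 0 else v i))) := by
  have hb : ∀ u w : ι → ℝ, (X *ᵥ u) ⬝ᵥ (X *ᵥ w) = ∑ i, ∑ j, (Xᵀ * X) i j * (u i * w j) := by
    intro u w
    rw [dotProduct_comm, dotProduct_mulVec, vecMul_mulVec, dotProduct_comm, dotProduct]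
    refine Finset.sum_congr rfl fun i _ => ?_
    rw [vecMul, dotProduct, Finset.mul_sum]
    refine Finset.sum_congr rfl fun j _ => ?_
    have : (Xᵀ * X) j i = (Xᵀ * X) i j := by
      simp only [Matrix.mul_apply, Matrix.transpose_apply, mul_comm]
    rw [this]
    ring
  rw [← Finset.mul_sum, ← Finset.mul_sum]
  simp_rw [hb]
  have e1 : ∀ I : Finset ι, ∑ i, ∑ j, (Xᵀ * X) i j *
      ((if i ∈ I then v i else 0) * (if j ∈ I then 0 else v j))
      = ∑ i, ∑ j, (Xᵀ * X) i j * (v i * v j) *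
        (if i ∈ I then (if j ∈ I then (0 : ℝ) else 1) else 0) := fun I =>
    Finset.sum_congr rfl fun i _ => Finset.sum_congr rfl fun j _ => by split_ifs <;> simp
  simp_rw [e1]
  simp_rw [Finset.sum_comm (s := (Finset.univ : Finset (Finset ι))), ← Finset.mul_sum]
  rw [eq_inv_mul_iff_mul_eq₀ (by positivity), mul_sub, Finset.mul_sum, Finset.mul_sum,
    Finset.mul_sum, ← Finset.sum_sub_distrib]
  refine Finset.sum_congr rfl fun i _ => ?_
  have e2 : ∀ j, 4 * ((Xᵀ * X) i j * (v i * v j) *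
      ∑ I : Finset ι, (if i ∈ I then (if j ∈ I then (0 : ℝ) else 1) else 0))
      = (2 : ℝ) ^ Fintype.card ι * ((Xᵀ * X) i j * (v i * v j)) -
        if i = j then (2 : ℝ) ^ Fintype.card ι * ((Xᵀ * X) i j * (v i * v j)) else 0 := by
    intro j
    rw [mul_left_comm, four_mul_sum_finset_separating]
    split_ifs <;> ring
  rw [Finset.mul_sum, Finset.mul_sum]
  simp_rw [e2]
  rw [Finset.sum_sub_distrib, Finset.sum_ite_eq, if_pos (Finset.mem_univ i)]
  ring

open Matrix in
-- By `offDiagonal_eq_average` the exponent is a uniform average over `I` of decoupled forms, so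
-- Jensen's inequality reduces to each `I` separately. The 16 is the square of the decoupling factor
-- 4.
theorem lintegral_exp_offDiagonal_le {Ω ι κ : Type*} [Fintype ι] [Fintype κ] [DecidableEq ι]
    [MeasurableSpace Ω] {μ : Measure Ω} [IsProbabilityMeasure μ] {y : ι → Ω → ℝ} {K : ℝ}
    (hy : ∀ i, Measurable (y i)) (hind : iIndepFun y μ)
    (hsub : ∀ i, HasSubgaussianMGF (y i) (Real.toNNReal (K ^ 2)) μ)
    (X : Matrix κ ι ℝ) {B : ℝ} (hB : ∀ v, (X *ᵥ v) ⬝ᵥ (X *ᵥ v) ≤ B ^ 2 * (v ⬝ᵥ v))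
    (hBT : ∀ w, (Xᵀ *ᵥ w) ⬝ᵥ (Xᵀ *ᵥ w) ≤ B ^ 2 * (w ⬝ᵥ w))
    {a : ℝ} (ha : 16 * K ^ 4 * a ^ 2 * B ^ 4 ≤ 1 / 2) :
    ∫⁻ ω, ENNReal.ofReal (Real.exp (a * ((X *ᵥ fun i => y i ω) ⬝ᵥ (X *ᵥ fun i => y i ω)
      - ∑ i, (Xᵀ * X) i i * y i ω ^ 2))) ∂μ
      ≤ ENNReal.ofReal (Real.exp (16 * K ^ 4 * a ^ 2 * B ^ 2 * (Xᵀ * X).trace)) := by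
  set q : ℝ := ((2 : ℝ) ^ Fintype.card ι)⁻¹ with hq
  have hq0 : 0 ≤ q := by positivity
  have hq1 : ∑ _I : Finset ι, q = 1 := by
    rw [Finset.sum_const, Finset.card_univ, Fintype.card_finset, nsmul_eq_mul, hq]
    push_cast
    exact mul_inv_cancel₀ (by positivity)
  let S : Finset ι → Ω → ℝ := fun I ω => (X *ᵥ fun i => if i ∈ I then y i ω else 0) ⬝ᵥ
          (X *ᵥ fun i => if i ∈ I then 0 else y i ω)
  have hS : ∀ I, Measurable (S I) := by
    intro I
    simp only [S, mulVec, dotProduct]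
    refine Finset.measurable_fun_sum _ fun k _ => Measurable.mul ?_ ?_ <;>
    · refine Finset.measurable_fun_sum _ fun i _ => ?_
      by_cases hi : i ∈ I <;> simp only [hi, if_true, if_false] <;> fun_prop
  have hpt : ∀ ω, ENNReal.ofReal (Real.exp (a * ((X *ᵥ fun i => y i ω) ⬝ᵥ (X *ᵥ fun i => y i ω)
      - ∑ i, (Xᵀ * X) i i * y i ω ^ 2)))
      ≤ ∑ I : Finset ι, ENNReal.ofReal q * ENNReal.ofReal (Real.exp (4 * a * S I ω)) := by
    intro ω
    have h := convexOn_exp.map_sum_le (t := (Finset.univ : Finset (Finset ι))) (w := fun _ => q)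
      (p := fun I => 4 * a * S I ω) (fun _ _ => hq0) hq1 (fun _ _ => Set.mem_univ _)
    simp only [smul_eq_mul] at h
    simp_rw [← ENNReal.ofReal_mul hq0]
    rw [← ENNReal.ofReal_sum_of_nonneg fun I _ => mul_nonneg hq0 (Real.exp_pos _).le]
    refine ENNReal.ofReal_le_ofReal (le_trans (le_of_eq ?_) h)
    rw [offDiagonal_eq_average, Finset.mul_sum]
    congr 1
    refine Finset.sum_congr rfl fun I _ => ?_
    simp only [S]
    ring
  refine (lintegral_mono hpt).trans ?_
  rw [lintegral_finsetSum _ fun I _ => by have := hS I; fun_prop]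
  have hI : ∀ I ∈ (Finset.univ : Finset (Finset ι)),
      ∫⁻ ω, ENNReal.ofReal q * ENNReal.ofReal (Real.exp (4 * a * S I ω)) ∂μ
      ≤ ENNReal.ofReal (q * Real.exp (16 * K ^ 4 * a ^ 2 * B ^ 2 * (Xᵀ * X).trace)) := by
    intro I _
    rw [lintegral_const_mul _ (by have := hS I; fun_prop), ENNReal.ofReal_mul hq0]
    refine mul_le_mul_right ((lintegral_exp_bilinear_split_le hy hind hsub X hB hBT
      (a := 4 * a) (le_trans (le_of_eq (by ring)) ha) I).trans (le_of_eq ?_)) _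
    congr 2
    ring
  refine (Finset.sum_le_sum hI).trans (le_of_eq ?_)
  rw [← ENNReal.ofReal_sum_of_nonneg fun I _ => mul_nonneg hq0 (Real.exp_pos _).le,
    ← Finset.sum_mul, hq1, one_mul]

/-! ### Chernoff bounds and Hanson–Wright -/

theorem measureReal_le_exp_sub_of_lintegral_exp_le {Ω : Type*} [MeasurableSpace Ω] {μ : Measure Ω}
    {f : Ω → ℝ} (hf : Measurable f) {b : ℝ}
    (h : ∫⁻ ω, ENNReal.ofReal (Real.exp (f ω)) ∂μ ≤ ENNReal.ofReal (Real.exp b)) (t : ℝ) :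
    μ.real {ω | t ≤ f ω} ≤ Real.exp (b - t) := by
  have h1 := mul_meas_ge_le_lintegral (μ := μ) (f := fun ω => ENNReal.ofReal (Real.exp (f ω)))
    (by fun_prop) (ENNReal.ofReal (Real.exp t))
  have e : {ω | ENNReal.ofReal (Real.exp t) ≤ ENNReal.ofReal (Real.exp (f ω))}
      = {ω | t ≤ f ω} := by
    ext ω
    simp [ENNReal.ofReal_le_ofReal_iff (Real.exp_pos _).le]
  rw [e] at h1
  have h2 := ENNReal.toReal_mono ENNReal.ofReal_ne_top (h1.trans h)
  rw [ENNReal.toReal_mul, ENNReal.toReal_ofReal (Real.exp_pos _).le,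
    ENNReal.toReal_ofReal (Real.exp_pos _).le] at h2
  rw [Real.exp_sub, le_div_iff₀ (Real.exp_pos _), mul_comm]
  exact h2

theorem hasSubgaussianMGF_of_abs_le {Ω : Type*} [MeasurableSpace Ω] {μ : Measure Ω}
    [IsProbabilityMeasure μ] {f : Ω → ℝ} {K : ℝ} (hf : Measurable f)
    (hb : ∀ᵐ ω ∂μ, |f ω| ≤ K) (h0 : ∫ ω, f ω ∂μ = 0) :
    HasSubgaussianMGF f (Real.toNNReal (K ^ 2)) μ := by
  have h := hasSubgaussianMGF_of_mem_Icc_of_integral_eq_zero (a := -K) (b := K) hf.aemeasurable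
    (hb.mono fun ω h => abs_le.1 h) h0
  convert! h using 1
  ext
  rw [Real.coe_toNNReal _ (sq_nonneg K), sub_neg_eq_add, ← two_mul]
  push_cast
  rw [norm_mul, Real.norm_two, mul_div_cancel_left₀ _ two_ne_zero, Real.norm_eq_abs, sq_abs]

theorem lintegral_exp_diagonal_le {Ω ι : Type*} [Fintype ι]
    [MeasurableSpace Ω] {μ : Measure Ω} [IsProbabilityMeasure μ] {y : ι → Ω → ℝ} {K : ℝ}
    (hy : ∀ i, Measurable (y i)) (hind : iIndepFun y μ)
    (hb : ∀ i, ∀ᵐ ω ∂μ, |y i ω| ≤ K) (h2 : ∀ i, ∫ ω, y i ω ^ 2 ∂μ = 1) (c : ι → ℝ) :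
    ∫⁻ ω, ENNReal.ofReal (Real.exp (∑ i, c i * (y i ω ^ 2 - 1))) ∂μ
      ≤ ENNReal.ofReal (Real.exp (K ^ 4 / 2 * ∑ i, c i ^ 2)) := by
  have hind' : iIndepFun (fun i ω => y i ω ^ 2 - 1) μ :=
    hind.comp (fun i x => x ^ 2 - 1) fun i => by fun_prop
  have hsub : ∀ i, HasSubgaussianMGF (fun ω => y i ω ^ 2 - 1) (Real.toNNReal ((K ^ 2) ^ 2)) μ := by
    intro i
    have hsq : ∀ᵐ ω ∂μ, y i ω ^ 2 ≤ K ^ 2 := (hb i).mono fun ω h => sq_le_sq' (abs_le.1 h).1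
      (abs_le.1 h).2
    have hint : Integrable (fun ω => y i ω ^ 2) μ :=
      Integrable.of_bound (by have := hy i; fun_prop) (K ^ 2)
        (hsq.mono fun ω h => by rwa [Real.norm_of_nonneg (sq_nonneg _)])
    -- Forced by the unit second moment; it gives `y² - 1 ≥ -K²`, hence `|y² - 1| ≤ K²`.
    have hK : 1 ≤ K ^ 2 := by
      have := integral_mono_ae hint (integrable_const (K ^ 2)) hsq
      simpa [h2 i] using this
    refine hasSubgaussianMGF_of_abs_le (by have := hy i; fun_prop) (hsq.mono fun ω h => ?_) ?_
    · rw [abs_le]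
      constructor <;> nlinarith [sq_nonneg (y i ω)]
    · rw [integral_sub hint (integrable_const 1), h2 i]
      simp
  refine (lintegral_exp_sum_mul_le hind' hsub c).trans (le_of_eq ?_)
  ring_nf

open Matrix in
/-- A Hanson–Wright type inequality for bounded independent coordinates. -/
theorem measureReal_quadratic_deviation_le {Ω ι κ : Type*} [Fintype ι] [Fintype κ] [DecidableEq ι]
    [MeasurableSpace Ω] {μ : Measure Ω} [IsProbabilityMeasure μ] {y : ι → Ω → ℝ} {K : ℝ}
    (hy : ∀ i, Measurable (y i)) (hind : iIndepFun y μ)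
    (hb : ∀ i, ∀ᵐ ω ∂μ, |y i ω| ≤ K) (h1 : ∀ i, ∫ ω, y i ω ∂μ = 0)
    (h2 : ∀ i, ∫ ω, y i ω ^ 2 ∂μ = 1) (hK : 1 ≤ K)
    (X : Matrix κ ι ℝ) {B : ℝ} (hB0 : 0 < B)
    (hB : ∀ v, (X *ᵥ v) ⬝ᵥ (X *ᵥ v) ≤ B ^ 2 * (v ⬝ᵥ v))
    (hBT : ∀ w, (Xᵀ *ᵥ w) ⬝ᵥ (Xᵀ *ᵥ w) ≤ B ^ 2 * (w ⬝ᵥ w))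
    {ε : ℝ} (hε0 : 0 ≤ ε) (hε1 : ε ≤ 1) :
    μ.real {ω | ε * (Xᵀ * X).trace ≤
      |(X *ᵥ fun i => y i ω) ⬝ᵥ (X *ᵥ fun i => y i ω) - (Xᵀ * X).trace|}
      ≤ 4 * Real.exp (-(ε ^ 2 * ((Xᵀ * X).trace / B ^ 2) / (256 * K ^ 4))) := by
  have hsub := fun i => hasSubgaussianMGF_of_abs_le (hy i) (hb i) (h1 i)
  set T := (Xᵀ * X).trace with hT
  have hdiag : ∀ i, 0 ≤ (Xᵀ * X) i i ∧ (Xᵀ * X) i i ≤ B ^ 2 := by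
    intro i
    have e : (Xᵀ * X) i i = (X *ᵥ Pi.single i 1) ⬝ᵥ (X *ᵥ Pi.single i 1) := by
      simp [Matrix.mul_apply, dotProduct]
    constructor
    · rw [e]
      exact Finset.sum_nonneg fun _ _ => mul_self_nonneg _
    · rw [e]
      simpa using hB (Pi.single i 1)
  have hT0 : 0 ≤ T := Finset.sum_nonneg fun i _ => (hdiag i).1
  have hdiag2 : ∑ i, (Xᵀ * X) i i ^ 2 ≤ B ^ 2 * T := by
    rw [hT, Matrix.trace, Finset.mul_sum]
    refine Finset.sum_le_sum fun i _ => ?_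
    rw [sq, Matrix.diag_apply]
    exact mul_le_mul_of_nonneg_right (hdiag i).2 (hdiag i).1
  let D : Ω → ℝ := fun ω => ∑ i, (Xᵀ * X) i i * (y i ω ^ 2 - 1)
  let O : Ω → ℝ := fun ω => (X *ᵥ fun i => y i ω) ⬝ᵥ (X *ᵥ fun i => y i ω)
      - ∑ i, (Xᵀ * X) i i * y i ω ^ 2
  have hDm : Measurable D := by fun_prop
  have hOm : Measurable O := by
    simp only [O, mulVec, dotProduct]
    fun_prop
  have hDO : ∀ ω, (X *ᵥ fun i => y i ω) ⬝ᵥ (X *ᵥ fun i => y i ω) - T = D ω + O ω := by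
    intro ω
    simp only [D, O, mul_sub, Finset.sum_sub_distrib, mul_one, hT, Matrix.trace, Matrix.diag_apply]
    ring
  have hK0 : 0 < K := by linarith
  -- The minimiser of the Chernoff exponent `16 K⁴ l² B² T - l ε T / 2`, whose value there is `-ε² T
  -- / (256 K⁴ B²)`.
  set l : ℝ := ε / (64 * K ^ 4 * B ^ 2) with hl
  have hl0 : 0 ≤ l := by positivity
  have hle : l * (K ^ 4 * B ^ 2) = ε / 64 := by
    rw [hl]
    field_simp
  set b := 16 * K ^ 4 * l ^ 2 * B ^ 2 * T with hbdef
  have hbound : ∀ f : Ω → ℝ, Measurable f →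
      ∫⁻ ω, ENNReal.ofReal (Real.exp (l * f ω)) ∂μ ≤ ENNReal.ofReal (Real.exp b) →
      μ.real {ω | ε * T / 2 ≤ f ω} ≤ Real.exp (-(ε ^ 2 * (T / B ^ 2) / (256 * K ^ 4))) := by
    intro f hf hfb
    have h := measureReal_le_exp_sub_of_lintegral_exp_le (hf.const_mul l) hfb (l * (ε * T / 2))
    refine le_trans (measureReal_mono fun ω hω => ?_) (h.trans (le_of_eq ?_))
    · exact mul_le_mul_of_nonneg_left hω hl0
    · congr 1
      rw [hbdef, hl]
      field_simp
      ring
  have hlin : 16 * K ^ 4 * l ^ 2 * B ^ 4 ≤ 1 / 2 := by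
    have hK4 : 1 ≤ K ^ 4 := one_le_pow₀ hK
    have h3 : 16 * K ^ 4 * l ^ 2 * B ^ 4 * K ^ 4 = ε ^ 2 / 256 := by
      calc _ = 16 * (l * (K ^ 4 * B ^ 2)) ^ 2 := by ring
        _ = _ := by rw [hle]; ring
    have h4 : 0 ≤ 16 * K ^ 4 * l ^ 2 * B ^ 4 := by positivity
    nlinarith
  have hO : ∀ a : ℝ, a ^ 2 = l ^ 2 →
      ∫⁻ ω, ENNReal.ofReal (Real.exp (a * O ω)) ∂μ ≤ ENNReal.ofReal (Real.exp b) := by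
    intro a ha
    have := lintegral_exp_offDiagonal_le hy hind hsub X hB hBT (a := a) (by rwa [ha])
    rwa [ha] at this
  have hD : ∀ a : ℝ, a ^ 2 = l ^ 2 →
      ∫⁻ ω, ENNReal.ofReal (Real.exp (a * D ω)) ∂μ ≤ ENNReal.ofReal (Real.exp b) := by
    intro a ha
    have := lintegral_exp_diagonal_le hy hind hb h2 (fun i => a * (Xᵀ * X) i i)
    simp only [D, Finset.mul_sum]
    simp_rw [mul_assoc] at this
    refine this.trans (ENNReal.ofReal_le_ofReal (Real.exp_le_exp.2 ?_))
    simp_rw [mul_pow, ← Finset.mul_sum, ha]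
    calc K ^ 4 / 2 * (l ^ 2 * ∑ i, (Xᵀ * X) i i ^ 2) ≤ K ^ 4 / 2 * (l ^ 2 * (B ^ 2 * T)) := by
          gcongr
      _ ≤ b := by
          rw [hbdef]
          have : 0 ≤ K ^ 4 * l ^ 2 * B ^ 2 * T := by positivity
          linarith
  -- Two parts with two signs each give four one-sided tails, hence the factor 4.
  have hsubset : {ω | ε * T ≤ |(X *ᵥ fun i => y i ω) ⬝ᵥ (X *ᵥ fun i => y i ω) - T|} ⊆
      ({ω | ε * T / 2 ≤ D ω} ∪ {ω | ε * T / 2 ≤ -D ω}) ∪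
      ({ω | ε * T / 2 ≤ O ω} ∪ {ω | ε * T / 2 ≤ -O ω}) := by
    intro ω hω
    simp only [Set.mem_ofPred_eq, hDO] at hω
    have := hω.trans (abs_add_le (D ω) (O ω))
    simp only [Set.mem_union, Set.mem_ofPred_eq, ← le_abs]
    by_contra! h
    linarith [h.1, h.2]
  have b1 := hbound D hDm (hD l rfl)
  have b2 := hbound (fun ω => -D ω) hDm.neg (by simpa using hD (-l) (by ring))
  have b3 := hbound O hOm (hO l rfl)
  have b4 := hbound (fun ω => -O ω) hOm.neg (by simpa using hO (-l) (by ring))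
  refine (measureReal_mono hsubset).trans ((measureReal_union_le _ _).trans ?_)
  have c1 := measureReal_union_le (μ := μ) {ω | ε * T / 2 ≤ D ω} {ω | ε * T / 2 ≤ -D ω}
  have c2 := measureReal_union_le (μ := μ) {ω | ε * T / 2 ≤ O ω} {ω | ε * T / 2 ≤ -O ω}
  linarith

/-! ### Independence and moments of the coordinates of `R^(ℓ) u` -/

theorem iIndepFun.curry {Ω ι κ : Type*} [MeasurableSpace Ω] {μ : Measure Ω}
    [IsProbabilityMeasure μ] {f : ι → κ → Ω → ℝ} (hf : ∀ i j, Measurable (f i j))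
    (h : iIndepFun (fun (p : ι × κ) ω => f p.1 p.2 ω) μ) :
    iIndepFun (fun i ω j => f i j ω) μ := by
  have : ∀ i j, IsProbabilityMeasure (μ.map (f i j)) :=
    fun i j => Measure.isProbabilityMeasure_map (hf i j).aemeasurable
  rw [iIndepFun_iff_map_fun_eq_infinitePi_map (by fun_prop)]
  have e1 := h.map_fun_eq_infinitePi_map (by fun_prop)
  have e2 : (fun ω i j => f i j ω) = MeasurableEquiv.curry ι κ ℝ ∘ fun ω p => f p.1 p.2 ω := rfl
  rw [e2, ← Measure.map_map (by fun_prop) (by fun_prop), e1,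
    Measure.infinitePi_map_curry (fun i j => μ.map (f i j))]
  congr 1
  ext1 i
  have hi : iIndepFun (f i) μ :=
    h.precomp (g := fun j => (i, j)) fun _ _ hab => (Prod.mk.inj hab).2
  rw [hi.map_fun_eq_infinitePi_map (by fun_prop)]

/-- The mean factors over indices: an index in both sets contributes a second moment 1, an index in
exactly one contributes a mean 0. -/
theorem iIndepFun.integral_prod_mul_prod {Ω ι : Type*} [Fintype ι] [DecidableEq ι]
    [MeasurableSpace Ω] {μ : Measure Ω} [IsProbabilityMeasure μ] {f : ι → Ω → ℝ}
    (hf : ∀ i, Measurable (f i)) (hind : iIndepFun f μ) (h1 : ∀ i, ∫ ω, f i ω ∂μ = 0)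
    (h2 : ∀ i, ∫ ω, f i ω ^ 2 ∂μ = 1) (s t : Finset ι) :
    ∫ ω, (∏ i ∈ s, f i ω) * ∏ i ∈ t, f i ω ∂μ = if s = t then 1 else 0 := by
  let g : ι → ℝ → ℝ := fun i x => (if i ∈ s then x else 1) * (if i ∈ t then x else 1)
  have hg : ∀ i, Measurable (g i) := by
    intro i
    by_cases hs : i ∈ s <;> by_cases ht : i ∈ t <;>
      simp only [g, hs, ht, if_true, if_false] <;> fun_prop
  have e : ∀ ω, (∏ i ∈ s, f i ω) * ∏ i ∈ t, f i ω = ∏ i, g i (f i ω) := by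
    intro ω
    simp only [g, Finset.prod_mul_distrib, Finset.prod_ite_mem, Finset.univ_inter]
  simp_rw [e]
  rw [hind.integral_fun_prod_comp (fun i => (hf i).aemeasurable)
    fun i => (hg i).aestronglyMeasurable]
  split_ifs with hst
  · subst hst
    refine Finset.prod_eq_one fun i _ => ?_
    by_cases hs : i ∈ s <;> simp [g, hs, ← sq, h2]
  · have : ∃ i, ¬(i ∈ s ↔ i ∈ t) := by
      by_contra! h
      exact hst (Finset.ext h)
    obtain ⟨i, hi⟩ := this
    refine Finset.prod_eq_zero (Finset.mem_univ i) ?_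
    by_cases hs : i ∈ s <;> by_cases ht : i ∈ t <;> simp_all [g]

theorem abs_prod_le_pow_card {ι : Type*} (s : Finset ι) (f : ι → ℝ) {τ : ℝ} (h : ∀ i, |f i| ≤ τ) :
    |∏ i ∈ s, f i| ≤ τ ^ s.card := by
  rw [Finset.abs_prod]
  exact (Finset.prod_le_prod (fun i _ => abs_nonneg _) fun i _ => h i).trans_eq
    (Finset.prod_const _)

section

variable {Ω : Type*} [MeasurableSpace Ω] {μ : Measure Ω} [IsProbabilityMeasure μ] {p d ℓ : ℕ}
  {R : Ω → Matrix (Fin p) (Fin d) ℝ} {τ : ℝ}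

open Matrix in
theorem columnHadamard_mulVec_apply (M : Matrix (Fin p) (Fin d) ℝ)
    (u : {s : Finset (Fin d) // s.card = ℓ} → ℝ) (r : Fin p) :
    (columnHadamard ℓ M *ᵥ u) r = ∑ s, u s * ∏ i ∈ s.1, M r i := by
  simp only [mulVec, dotProduct, columnHadamard, Matrix.of_apply, mul_comm]

open Matrix in
theorem measurable_columnHadamard_mulVec (hm : ∀ i j, Measurable fun ω => R ω i j)
    (u : {s : Finset (Fin d) // s.card = ℓ} → ℝ) (r : Fin p) :
    Measurable fun ω => (columnHadamard ℓ (R ω) *ᵥ u) r := by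
  simp only [columnHadamard_mulVec_apply]
  fun_prop

open Matrix in
theorem iIndepFun_columnHadamard_mulVec (hm : ∀ i j, Measurable fun ω => R ω i j)
    (hind : iIndepFun (fun (ij : Fin p × Fin d) ω => R ω ij.1 ij.2) μ)
    (u : {s : Finset (Fin d) // s.card = ℓ} → ℝ) :
    iIndepFun (fun r ω => (columnHadamard ℓ (R ω) *ᵥ u) r) μ := by
  simp only [columnHadamard_mulVec_apply]
  exact (iIndepFun.curry (f := fun i j ω => R ω i j) hm hind).comp
    (fun _ x => ∑ s : {s : Finset (Fin d) // s.card = ℓ}, u s * ∏ i ∈ s.1, x i)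
    fun _ => by fun_prop

omit [IsProbabilityMeasure μ] in
open Matrix in
theorem abs_columnHadamard_mulVec_le (hτ : ∀ i j, ∀ᵐ ω ∂μ, |R ω i j| ≤ τ)
    (u : {s : Finset (Fin d) // s.card = ℓ} → ℝ) (r : Fin p) :
    ∀ᵐ ω ∂μ, |(columnHadamard ℓ (R ω) *ᵥ u) r| ≤ (∑ s, |u s|) * τ ^ ℓ := by
  filter_upwards [ae_all_iff.2 (hτ r)] with ω hω
  rw [columnHadamard_mulVec_apply, Finset.sum_mul]
  refine (Finset.abs_sum_le_sum_abs _ _).trans (Finset.sum_le_sum fun s _ => ?_)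
  rw [abs_mul]
  refine mul_le_mul_of_nonneg_left ?_ (abs_nonneg _)
  simpa [s.2] using abs_prod_le_pow_card s.1 (fun i => R ω r i) hω

theorem integrable_prod_row (hm : ∀ i j, Measurable fun ω => R ω i j)
    (hτ : ∀ i j, ∀ᵐ ω ∂μ, |R ω i j| ≤ τ) (r : Fin p) (s t : Finset (Fin d)) :
    Integrable (fun ω => (∏ i ∈ s, R ω r i) * ∏ i ∈ t, R ω r i) μ := by
  refine Integrable.of_bound (Measurable.aestronglyMeasurable (by fun_prop))
    (τ ^ s.card * τ ^ t.card) ?_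
  filter_upwards [ae_all_iff.2 (hτ r)] with ω hω
  rw [Real.norm_eq_abs, abs_mul]
  have h1 := abs_prod_le_pow_card s (fun i => R ω r i) hω
  exact mul_le_mul h1 (abs_prod_le_pow_card t (fun i => R ω r i) hω) (abs_nonneg _)
    ((abs_nonneg _).trans h1)

open Matrix in
theorem integral_columnHadamard_mulVec (hℓ : ℓ ≠ 0) (hm : ∀ i j, Measurable fun ω => R ω i j)
    (hind : iIndepFun (fun (ij : Fin p × Fin d) ω => R ω ij.1 ij.2) μ)
    (h1 : ∀ i j, ∫ ω, R ω i j ∂μ = 0) (h2 : ∀ i j, ∫ ω, (R ω i j) ^ 2 ∂μ = 1)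
    (hτ : ∀ i j, ∀ᵐ ω ∂μ, |R ω i j| ≤ τ)
    (u : {s : Finset (Fin d) // s.card = ℓ} → ℝ) (r : Fin p) :
    ∫ ω, (columnHadamard ℓ (R ω) *ᵥ u) r ∂μ = 0 := by
  have hrow : iIndepFun (fun j ω => R ω r j) μ :=
    hind.precomp (g := fun j => (r, j)) fun _ _ hab => (Prod.mk.inj hab).2
  simp only [columnHadamard_mulVec_apply]
  rw [integral_finsetSum _ fun s _ => by
    simpa using (integrable_prod_row hm hτ r s.1 ∅).const_mul (u s)]
  refine Finset.sum_eq_zero fun s _ => ?_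
  -- The mean is the pairing with the empty product; `ℓ ≠ 0` makes the two sets different.
  have h := iIndepFun.integral_prod_mul_prod (hm r) hrow (h1 r) (h2 r) s.1 ∅
  have hs : s.1 ≠ ∅ := by
    intro h0
    have := s.2
    rw [h0] at this
    exact hℓ (by simpa using this.symm)
  simp only [Finset.prod_empty, mul_one, if_neg hs] at h
  rw [integral_const_mul, h, mul_zero]

open Matrix in
theorem integral_columnHadamard_mulVec_sq (hm : ∀ i j, Measurable fun ω => R ω i j)
    (hind : iIndepFun (fun (ij : Fin p × Fin d) ω => R ω ij.1 ij.2) μ)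
    (h1 : ∀ i j, ∫ ω, R ω i j ∂μ = 0) (h2 : ∀ i j, ∫ ω, (R ω i j) ^ 2 ∂μ = 1)
    (hτ : ∀ i j, ∀ᵐ ω ∂μ, |R ω i j| ≤ τ)
    (u : {s : Finset (Fin d) // s.card = ℓ} → ℝ) (r : Fin p) :
    ∫ ω, (columnHadamard ℓ (R ω) *ᵥ u) r ^ 2 ∂μ = ∑ s, u s ^ 2 := by
  have hrow : iIndepFun (fun j ω => R ω r j) μ :=
    hind.precomp (g := fun j => (r, j)) fun _ _ hab => (Prod.mk.inj hab).2
  have e : ∀ ω, (columnHadamard ℓ (R ω) *ᵥ u) r ^ 2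
      = ∑ s : {s : Finset (Fin d) // s.card = ℓ}, ∑ t : {s : Finset (Fin d) // s.card = ℓ},
        (u s * u t) * ((∏ i ∈ s.1, R ω r i) * ∏ i ∈ t.1, R ω r i) := by
    intro ω
    rw [columnHadamard_mulVec_apply, sq, Finset.sum_mul_sum]
    exact Finset.sum_congr rfl fun s _ => Finset.sum_congr rfl fun t _ => by ring
  have hint : ∀ s t : {s : Finset (Fin d) // s.card = ℓ}, Integrable (fun ω =>
      (u s * u t) * ((∏ i ∈ s.1, R ω r i) * ∏ i ∈ t.1, R ω r i)) μ := fun s t =>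
    (integrable_prod_row hm hτ r s.1 t.1).const_mul _
  simp_rw [e]
  rw [integral_finsetSum _ fun s _ => integrable_finsetSum _ fun t _ => hint s t]
  refine Finset.sum_congr rfl fun s _ => ?_
  rw [integral_finsetSum _ fun t _ => hint s t]
  simp_rw [integral_const_mul,
    iIndepFun.integral_prod_mul_prod (hm r) hrow (h1 r) (h2 r), ← Subtype.ext_iff]
  simp [sq]

end

/-! ### Matrix norms, polarization, and isometry from Gram entries -/

open Matrix in
theorem frobeniusNorm_sq {m n : Type*} [Fintype m] [Fintype n] (A : Matrix m n ℝ) :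
    frobeniusNorm A ^ 2 = (Aᵀ * A).trace := by
  rw [frobeniusNorm, Matrix.frobenius_norm_def, ← Real.sqrt_eq_rpow, Real.sq_sqrt
    (Finset.sum_nonneg fun _ _ => Finset.sum_nonneg fun _ _ => by positivity)]
  simp only [Matrix.trace, Matrix.diag_apply, Matrix.mul_apply, Matrix.transpose_apply]
  rw [Finset.sum_comm]
  simp [sq]

theorem norm_toLp_sq {m : Type*} [Fintype m] (v : m → ℝ) :
    ‖WithLp.toLp 2 v‖ ^ 2 = v ⬝ᵥ v := by
  rw [EuclideanSpace.norm_sq_eq]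
  simp [dotProduct, sq]

open Matrix in
theorem mulVec_dotProduct_self_le {m n : Type*} [Fintype m] [Fintype n] [DecidableEq n]
    (A : Matrix m n ℝ) (v : n → ℝ) :
    (A *ᵥ v) ⬝ᵥ (A *ᵥ v) ≤ matrixSpectralNorm A ^ 2 * (v ⬝ᵥ v) := by
  rw [← norm_toLp_sq, ← norm_toLp_sq, ← mul_pow]
  exact pow_le_pow_left₀ (norm_nonneg _) (Matrix.l2_opNorm_mulVec A (WithLp.toLp 2 v)) 2

theorem matrixSpectralNorm_transpose {m n : Type*} [Fintype m] [Fintype n] [DecidableEq n]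
    [DecidableEq m] (A : Matrix m n ℝ) :
    matrixSpectralNorm A.transpose = matrixSpectralNorm A := by
  rw [← Matrix.conjTranspose_eq_transpose_of_trivial]
  exact Matrix.l2_opNorm_conjTranspose A

open scoped Matrix.Norms.L2Operator in
theorem matrixSpectralNorm_pos {m n : Type*} [Fintype m] [Fintype n] [DecidableEq n]
    {A : Matrix m n ℝ} (hA : A ≠ 0) : 0 < matrixSpectralNorm A :=
  norm_pos_iff.2 hA

/-- The unit vectors `e_s` (when `s = t`) and `(e_s ± e_t) / √2` used for polarization. -/
noncomputable def polarizationVector {ι : Type*} [DecidableEq ι] (s t : ι) (b : Bool) : ι → ℝ :=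
  if s = t then Pi.single s 1
  else (√2)⁻¹ • (Pi.single s 1 + (if b then (1 : ℝ) else -1) • Pi.single t 1)

theorem sum_polarizationVector_sq {ι : Type*} [Fintype ι] [DecidableEq ι] (s t : ι) (b : Bool) :
    ∑ i, polarizationVector s t b i ^ 2 = 1 := by
  unfold polarizationVector
  split_ifs with h hb
  · rw [Finset.sum_eq_single s] <;> simp +contextual
  all_goals
    rw [Fintype.sum_eq_add s t h]
    · norm_num [Pi.single_apply, h, Ne.symm h, mul_pow]
    · rintro i ⟨h1, h2⟩
      simp [h1, h2]

/-- Keeps the sup bound on the coordinates of `R^(ℓ) u` at `√2 τ^ℓ`, independent of `k`. -/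
theorem sum_abs_polarizationVector_le {ι : Type*} [Fintype ι] [DecidableEq ι] (s t : ι)
    (b : Bool) : ∑ i, |polarizationVector s t b i| ≤ √2 := by
  have h2 : (1 : ℝ) ≤ √2 := Real.one_le_sqrt.2 one_le_two
  unfold polarizationVector
  split_ifs with h hb
  · rw [Finset.sum_eq_single s] <;> simp +contextual [h2]
  all_goals
    rw [Fintype.sum_eq_add s t h]
    · have h3 : (√2)⁻¹ + (√2)⁻¹ = √2 := by
        have : √2 ≠ 0 := by positivity
        field_simp
        norm_num
      have h4 : |√2| = √2 := abs_of_pos (by positivity)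
      simp [h, Ne.symm h, abs_inv, h4, h3]
    · rintro i ⟨h1, h2⟩
      simp [h1, h2]

open Matrix in
-- Off the diagonal, the entry is half the difference of the two quadratic values, so `a` cancels.
theorem abs_gram_entry_sub_le {m ι : Type*} [Fintype m] [Fintype ι] [DecidableEq ι]
    (Z : Matrix m ι ℝ) {a δ : ℝ} (s t : ι)
    (h : ∀ b, |(Z *ᵥ polarizationVector s t b) ⬝ᵥ (Z *ᵥ polarizationVector s t b) - a| ≤ δ) :
    |(Zᵀ * Z) s t - if s = t then a else 0| ≤ δ := by
  have hd : ∀ s t, (Zᵀ * Z) s t = (Z *ᵥ Pi.single s 1) ⬝ᵥ (Z *ᵥ Pi.single t 1) := by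
    intro s t
    simp [Matrix.mul_apply, dotProduct]
  by_cases hst : s = t
  · subst hst
    simpa [polarizationVector, hd] using h true
  · have h1 := h true
    have h2 := h false
    simp only [polarizationVector, if_neg hst, if_true, Bool.false_eq_true, if_false, one_smul,
      mulVec_smul, mulVec_add, smul_dotProduct, dotProduct_smul, add_dotProduct, dotProduct_add,
      smul_eq_mul, neg_smul, mulVec_neg, neg_dotProduct, dotProduct_neg] at h1 h2
    rw [if_neg hst, hd, sub_zero]
    have hc : (Z *ᵥ Pi.single t 1) ⬝ᵥ (Z *ᵥ Pi.single s 1)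
      = (Z *ᵥ Pi.single s 1) ⬝ᵥ (Z *ᵥ Pi.single t 1) := dotProduct_comm _ _
    have h3 : (√2)⁻¹ * (√2)⁻¹ = (1 : ℝ) / 2 := by
      rw [← mul_inv, Real.mul_self_sqrt zero_le_two, one_div]
    rw [hc] at h1 h2
    generalize (Z *ᵥ Pi.single s 1) ⬝ᵥ (Z *ᵥ Pi.single s 1) = x at h1 h2
    generalize (Z *ᵥ Pi.single s 1) ⬝ᵥ (Z *ᵥ Pi.single t 1) = y at h1 h2 ⊢
    generalize (Z *ᵥ Pi.single t 1) ⬝ᵥ (Z *ᵥ Pi.single t 1) = z at h1 h2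
    have h1 : |(x + z) / 2 + y - a| ≤ δ := by
      convert h1 using 3
      linear_combination (-(x + 2 * y + z)) * h3
    have h2 : |(x + z) / 2 - y - a| ≤ δ := by
      convert h2 using 3
      linear_combination (-(x - 2 * y + z)) * h3
    rw [abs_le] at h1 h2 ⊢
    constructor <;> linarith [h1.1, h1.2, h2.1, h2.2]

open Matrix in
-- Entrywise error `δ` costs at most `δ‖u‖₁²`, and Cauchy–Schwarz on the support gives `‖u‖₁² ≤
-- k‖u‖²`.
theorem abs_quadratic_sub_le_of_gram_entries {m ι : Type*} [Fintype m] [Fintype ι]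
    [DecidableEq ι] (Z : Matrix m ι ℝ) {a δ : ℝ} (hδ : 0 ≤ δ)
    (h : ∀ s t, |(Zᵀ * Z) s t - if s = t then a else 0| ≤ δ)
    (u : ι → ℝ) {k : ℕ} (hk : {i | u i ≠ 0}.ncard ≤ k) :
    |(Z *ᵥ u) ⬝ᵥ (Z *ᵥ u) - a * (u ⬝ᵥ u)| ≤ δ * k * (u ⬝ᵥ u) := by
  have e1 : (Z *ᵥ u) ⬝ᵥ (Z *ᵥ u) = ∑ s, ∑ t, u s * u t * (Zᵀ * Z) s t := by
    rw [dotProduct_mulVec, vecMul_mulVec, dotProduct, Finset.sum_comm]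
    refine Finset.sum_congr rfl fun t _ => ?_
    rw [vecMul, dotProduct, Finset.sum_mul]
    exact Finset.sum_congr rfl fun s _ => by ring
  have e2 : a * (u ⬝ᵥ u) = ∑ s, ∑ t, u s * u t * (if s = t then a else 0) := by
    simp only [mul_ite, mul_zero, Finset.sum_ite_eq, Finset.mem_univ, if_true, dotProduct,
      Finset.mul_sum]
    exact Finset.sum_congr rfl fun s _ => by ring
  have hsup : (∑ s, |u s|) ^ 2 ≤ k * (u ⬝ᵥ u) := by
    have e3 : ∑ s, |u s| = ∑ s with u s ≠ 0, |u s| := by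
      rw [Finset.sum_filter]
      exact Finset.sum_congr rfl fun s _ => by split_ifs <;> simp_all
    have e4 : (Finset.univ.filter fun s => u s ≠ 0).card ≤ k := by
      rwa [Set.ncard_eq_toFinset_card', Set.toFinset_ofPred] at hk
    rw [e3]
    refine (sq_sum_le_card_mul_sum_sq).trans ?_
    refine mul_le_mul (by exact_mod_cast e4) ?_ (Finset.sum_nonneg fun _ _ => sq_nonneg _)
      (Nat.cast_nonneg k)
    refine (Finset.sum_le_sum_of_subset_of_nonneg (Finset.filter_subset _ _)
      fun _ _ _ => sq_nonneg _).trans (le_of_eq ?_)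
    simp [dotProduct, sq]
  rw [e1, e2, ← Finset.sum_sub_distrib]
  simp_rw [← Finset.sum_sub_distrib, ← mul_sub]
  calc _ ≤ ∑ s, ∑ t, |u s| * |u t| * δ := by
        refine (Finset.abs_sum_le_sum_abs _ _).trans (Finset.sum_le_sum fun s _ => ?_)
        refine (Finset.abs_sum_le_sum_abs _ _).trans (Finset.sum_le_sum fun t _ => ?_)
        rw [abs_mul, abs_mul]
        exact mul_le_mul_of_nonneg_left (h s t) (by positivity)
    _ = δ * (∑ s, |u s|) ^ 2 := by
        rw [sq, Finset.sum_mul_sum, Finset.mul_sum]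
        refine Finset.sum_congr rfl fun s _ => ?_
        rw [Finset.mul_sum]
        exact Finset.sum_congr rfl fun t _ => by ring
    _ ≤ δ * (k * (u ⬝ᵥ u)) := mul_le_mul_of_nonneg_left hsup hδ
    _ = _ := by ring

open Matrix in
-- The Gram bound puts the squared norm in `(1 ± ε)‖X‖_F²`; square roots are taken through `(1 - ε)²
-- ≤ 1 - ε` and `1 + ε ≤ (1 + ε)²`.
theorem satisfiesRIP_of_polarization {m n ι : Type*} [Fintype m] [Fintype n] [Fintype ι]
    [DecidableEq ι] (X : Matrix m n ℝ) (A : Matrix n ι ℝ) {k : ℕ} (hk : 1 ≤ k) {ε : ℝ}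
    (hε0 : 0 < ε) (hε1 : ε < 1)
    (h : ∀ s t b, |(X *ᵥ (A *ᵥ polarizationVector s t b)) ⬝ᵥ
      (X *ᵥ (A *ᵥ polarizationVector s t b)) - (Xᵀ * X).trace| ≤ ε / k * (Xᵀ * X).trace) :
    SatisfiesRIP X A k ε := by
  intro u hu hku
  have hk0 : (0 : ℝ) < k := by exact_mod_cast hk
  have hF0 : 0 ≤ frobeniusNorm X := by
    unfold frobeniusNorm
    exact @norm_nonneg _ (Matrix.frobeniusSeminormedAddCommGroup.toSeminormedAddGroup) X
  simp_rw [mulVec_mulVec] at h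
  have hT : 0 ≤ (Xᵀ * X).trace := by rw [← frobeniusNorm_sq]; positivity
  have h1 := abs_quadratic_sub_le_of_gram_entries (X * A) (by positivity)
    (fun s t => abs_gram_entry_sub_le (X * A) s t (h s t)) u.ofLp hku
  have hu1 : u.ofLp ⬝ᵥ u.ofLp = 1 := by
    rw [← norm_toLp_sq, WithLp.toLp_ofLp, hu, one_pow]
  rw [hu1, ← norm_toLp_sq, mul_one, mul_one, ← frobeniusNorm_sq, div_mul_eq_mul_div,
    div_mul_cancel₀ _ hk0.ne', abs_le] at h1
  set N := ‖WithLp.toLp 2 ((X * A) *ᵥ u.ofLp)‖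
  have hN : 0 ≤ N := norm_nonneg _
  set F := frobeniusNorm X
  have hF2 := sq_nonneg F
  constructor
  · refine le_of_sq_le_sq ?_ hN
    nlinarith [mul_nonneg (mul_nonneg hε0.le (by linarith : 0 ≤ 1 - ε)) hF2]
  · refine le_of_sq_le_sq ?_ (by positivity)
    nlinarith [mul_nonneg (mul_nonneg hε0.le hε0.le) hF2, mul_nonneg hε0.le hF2]

/-! ### Union bound and conclusion -/

/-- Write `log L = log(L/k) + log k`; then `log k ≤ k - 1 ≤ (k - 1) log(L/k)` because `L/k ≥ 6 > e`.
-/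
theorem log_le_mul_log_div {L : ℝ} {k : ℕ} (hk : 1 ≤ k) (hL : 6 * (k : ℝ) ≤ L) :
    Real.log L ≤ k * Real.log (L / k) := by
  have hk1 : (1 : ℝ) ≤ k := by exact_mod_cast hk
  have hk0 : (0 : ℝ) < k := by linarith
  have hL0 : 0 < L := by linarith
  have h1 : 1 ≤ Real.log (L / k) := by
    rw [Real.le_log_iff_exp_le (by positivity), le_div_iff₀ hk0]
    nlinarith [Real.exp_one_lt_d9]
  have h2 := Real.log_le_sub_one_of_pos hk0
  have h3 : Real.log L = Real.log (L / k) + Real.log k := by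
    rw [Real.log_div hL0.ne' hk0.ne']
    ring
  nlinarith [mul_le_mul_of_nonneg_left h1 (by linarith : (0 : ℝ) ≤ k - 1)]

theorem six_mul_choose_le_pow {d ℓ : ℕ} (hℓ : 3 ≤ ℓ) : 6 * d.choose ℓ ≤ d ^ ℓ := by
  calc 6 * d.choose ℓ ≤ ℓ.factorial * d.choose ℓ :=
        Nat.mul_le_mul_right _ (Nat.factorial_le hℓ)
    _ = d.descFactorial ℓ := (Nat.descFactorial_eq_factorial_mul_choose d ℓ).symm
    _ ≤ d ^ ℓ := Nat.descFactorial_le_pow d ℓ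

theorem mainTheorem6 :
    ∃ C c : ℝ, 0 < C ∧ 0 < c ∧
      ∀ (ℓ : ℕ), 3 ≤ ℓ →
      ∀ (n p d : ℕ) (X : Matrix (Fin n) (Fin p) ℝ)
        {Ω : Type*} [MeasurableSpace Ω] (μ : Measure Ω) [IsProbabilityMeasure μ]
        (R : Ω → Matrix (Fin p) (Fin d) ℝ) (τ : ℝ),
        (∀ i j, Measurable fun ω => R ω i j) →
        iIndepFun (fun (ij : Fin p × Fin d) ω => R ω ij.1 ij.2) μ →
        (∀ i j, ∫ ω, R ω i j ∂μ = 0) →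
        (∀ i j, ∫ ω, (R ω i j) ^ 2 ∂μ = 1) →
        (∀ i j, ∀ᵐ ω ∂μ, |R ω i j| ≤ τ) →
        ∀ (ε : ℝ), 0 < ε → ε < 1 →
        ∀ (k : ℕ), 1 ≤ k → k ≤ d.choose ℓ →
          C * τ ^ (4 * ℓ) * (k : ℝ) ^ 3 / ε ^ 2 * Real.log ((d : ℝ) ^ ℓ / k) ≤ stableRank X →
          1 - Real.exp (-(c * ε ^ 2 * stableRank X / ((k : ℝ) ^ 2 * τ ^ (4 * ℓ)))) ≤
            μ.real {ω | SatisfiesRIP X (columnHadamard ℓ (R ω)) k ε} := by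
  -- Each tail is `4 exp(-Q/1024)`, where `1024 = 256 · 4` and the 4 is `(√2)⁴`. Half of this
  -- exponent absorbs the union bound, which needs `2 log d^ℓ ≤ Q/2048`.
  refine ⟨4096, 1 / 2048, by norm_num, by norm_num, ?_⟩
  intro ℓ hℓ n p d X Ω _ μ _ R τ hm hind h1 h2 hτ ε hε0 hε1 k hk hkN hsr
  by_cases hX : X = 0
  · have : {ω | SatisfiesRIP X (columnHadamard ℓ (R ω)) k ε} = Set.univ := by
      rw [Set.eq_univ_iff_forall]
      intro ω
      refine satisfiesRIP_of_polarization X _ hk hε0 hε1 fun s t b => ?_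
      simp [hX]
    rw [this, probReal_univ]
    linarith [Real.exp_pos (-(1 / 2048 * ε ^ 2 * stableRank X / ((k : ℝ) ^ 2 * τ ^ (4 * ℓ))))]
  have hp : Nonempty (Fin p) := by
    by_contra h
    rw [not_nonempty_iff] at h
    exact hX (Matrix.ext fun _ j => h.elim j)
  have hd : 0 < d := by
    by_contra! h
    have : d.choose ℓ = 0 := Nat.choose_eq_zero_of_lt (by omega)
    omega
  obtain ⟨r0⟩ := hp
  -- The unit second moment of any one entry forces this; `X ≠ 0` and `k ≤ d.choose ℓ` guarantee
  -- that an entry exists.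
  have hτ1 : 1 ≤ τ := by
    have hR := hτ r0 ⟨0, hd⟩
    obtain ⟨ω, hω⟩ := hR.exists
    have hτ0 : 0 ≤ τ := (abs_nonneg _).trans hω
    have hsq : ∀ᵐ ω ∂μ, R ω r0 ⟨0, hd⟩ ^ 2 ≤ τ ^ 2 :=
      hR.mono fun ω h => sq_le_sq' (abs_le.1 h).1 (abs_le.1 h).2
    have hint : Integrable (fun ω => R ω r0 ⟨0, hd⟩ ^ 2) μ :=
      Integrable.of_bound ((hm r0 ⟨0, hd⟩).pow_const 2).aestronglyMeasurable (τ ^ 2)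
        (hsq.mono fun ω h => by rwa [Real.norm_of_nonneg (sq_nonneg _)])
    have := integral_mono_ae hint (integrable_const (τ ^ 2)) hsq
    rw [h2] at this
    simp only [integral_const, probReal_univ, one_smul] at this
    nlinarith
  have hτℓ : 1 ≤ τ ^ ℓ := one_le_pow₀ hτ1
  have hk1 : (1 : ℝ) ≤ k := by exact_mod_cast hk
  have hk0 : (0 : ℝ) < k := by linarith
  have hs2 : (1 : ℝ) ≤ √2 := Real.one_le_sqrt.2 one_le_two
  set B := matrixSpectralNorm X
  have hB0 : 0 < B := matrixSpectralNorm_pos hX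
  set T := (X.transpose * X).trace with hTdef
  have hsrT : stableRank X = T / B ^ 2 := by rw [stableRank, frobeniusNorm_sq]
  set Q := ε ^ 2 * stableRank X / ((k : ℝ) ^ 2 * τ ^ (4 * ℓ)) with hQ
  have hτ4 : 0 < τ ^ (4 * ℓ) := by positivity
  let V := {s : Finset (Fin d) // s.card = ℓ}
  let bad : V × V × Bool → Set Ω := fun j => {ω | ε / k * T ≤
    |(X.mulVec fun i => (columnHadamard ℓ (R ω)).mulVec (polarizationVector j.1 j.2.1 j.2.2) i) ⬝ᵥ
     (X.mulVec fun i => (columnHadamard ℓ (R ω)).mulVec (polarizationVector j.1 j.2.1 j.2.2) i)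
      - T|}
  have hbad : ∀ j, μ.real (bad j) ≤ 4 * Real.exp (-(Q / 1024)) := by
    intro j
    set u := polarizationVector j.1 j.2.1 j.2.2
    have hb : ∀ r, ∀ᵐ ω ∂μ, |(columnHadamard ℓ (R ω)).mulVec u r| ≤ √2 * τ ^ ℓ := fun r =>
      (abs_columnHadamard_mulVec_le hτ u r).mono fun ω h => h.trans
        (mul_le_mul_of_nonneg_right (sum_abs_polarizationVector_le _ _ _) (by positivity))
    have hBT := mulVec_dotProduct_self_le X.transpose
    rw [matrixSpectralNorm_transpose] at hBT
    have h := measureReal_quadratic_deviation_le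
      (measurable_columnHadamard_mulVec hm u) (iIndepFun_columnHadamard_mulVec hm hind u) hb
      (integral_columnHadamard_mulVec (by omega) hm hind h1 h2 hτ u)
      (fun r => (integral_columnHadamard_mulVec_sq hm hind h1 h2 hτ u r).trans
        (sum_polarizationVector_sq _ _ _)) (one_le_mul_of_one_le_of_one_le hs2 hτℓ) X hB0
      (mulVec_dotProduct_self_le X) hBT (ε := ε / k) (by positivity)
      ((div_le_one hk0).2 (by linarith))
    refine h.trans (le_of_eq ?_)
    have h4 : (√2 * τ ^ ℓ) ^ 4 = 4 * τ ^ (4 * ℓ) := by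
      rw [mul_pow, ← pow_mul, mul_comm ℓ 4]
      congr 1
      rw [show (4 : ℕ) = 2 * 2 from rfl, pow_mul, Real.sq_sqrt zero_le_two]
      norm_num
    rw [h4, hQ, hsrT, ← hTdef]
    congr 3
    field_simp
    ring
  have hcover : {ω | SatisfiesRIP X (columnHadamard ℓ (R ω)) k ε}ᶜ ⊆ ⋃ j ∈ Finset.univ, bad j := by
    intro ω hω
    by_contra hn
    refine hω (satisfiesRIP_of_polarization X _ hk hε0 hε1 fun s t b => ?_)
    simp only [Set.mem_iUnion, not_exists] at hn
    exact (not_le.1 (hn (s, t, b) (Finset.mem_univ _))).le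
  set N := d.choose ℓ
  have hcard : (Finset.univ : Finset (V × V × Bool)).card = N * (N * 2) := by
    rw [Finset.card_univ, Fintype.card_prod, Fintype.card_prod, Fintype.card_bool,
      Fintype.card_finset_len, Fintype.card_fin]
  have hcompl : μ.real {ω | SatisfiesRIP X (columnHadamard ℓ (R ω)) k ε}ᶜ
      ≤ 8 * (N : ℝ) ^ 2 * Real.exp (-(Q / 1024)) := by
    refine (measureReal_mono hcover (measure_ne_top _ _)).trans ((measureReal_biUnion_finset_le _ _).trans ?_)
    refine (Finset.sum_le_sum fun j _ => hbad j).trans (le_of_eq ?_)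
    rw [Finset.sum_const, hcard, nsmul_eq_mul]
    push_cast
    ring
  have hNL : 6 * (N : ℝ) ≤ (d : ℝ) ^ ℓ := by exact_mod_cast six_mul_choose_le_pow hℓ
  have hkN' : (k : ℝ) ≤ N := by exact_mod_cast hkN
  have hlog := log_le_mul_log_div (L := (d : ℝ) ^ ℓ) hk (by linarith)
  have hL0 : (0 : ℝ) < (d : ℝ) ^ ℓ := by positivity
  -- `Q` already carries `k²` in its denominator; the third factor `k` in the hypothesis upgrades
  -- `log(d^ℓ/k)` to `log d^ℓ`.
  have hQlog : 4096 * Real.log ((d : ℝ) ^ ℓ) ≤ Q := by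
    have e : 4096 * (k * Real.log ((d : ℝ) ^ ℓ / k)) ≤ Q := by
      rw [hQ, le_div_iff₀ (by positivity)]
      calc _ = ε ^ 2 * (4096 * τ ^ (4 * ℓ) * (k : ℝ) ^ 3 / ε ^ 2 *
            Real.log ((d : ℝ) ^ ℓ / k)) := by
            field_simp
        _ ≤ _ := mul_le_mul_of_nonneg_left hsr (by positivity)
    linarith
  have hfinal : 8 * (N : ℝ) ^ 2 * Real.exp (-(Q / 1024)) ≤ Real.exp (-(Q / 2048)) := by
    -- From `6N ≤ d^ℓ`: `8N² ≤ 36N² ≤ (d^ℓ)²`.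
    have hN2 : 8 * (N : ℝ) ^ 2 ≤ Real.exp (Q / 2048) := by
      have hl : ((d : ℝ) ^ ℓ) ^ 2 ≤ Real.exp (Q / 2048) := by
        rw [← Real.log_le_iff_le_exp (by positivity), Real.log_pow]
        push_cast
        linarith
      nlinarith [pow_le_pow_left₀ (by positivity) hNL 2]
    calc _ ≤ Real.exp (Q / 2048) * Real.exp (-(Q / 1024)) :=
          mul_le_mul_of_nonneg_right hN2 (Real.exp_pos _).le
      _ = _ := by rw [← Real.exp_add]; congr 1; ring
  -- Subadditivity suffices, so measurability of the isometry event is not needed.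
  have hone : 1 ≤ μ.real {ω | SatisfiesRIP X (columnHadamard ℓ (R ω)) k ε}
      + μ.real {ω | SatisfiesRIP X (columnHadamard ℓ (R ω)) k ε}ᶜ := by
    have := measureReal_union_le (μ := μ) {ω | SatisfiesRIP X (columnHadamard ℓ (R ω)) k ε}
      {ω | SatisfiesRIP X (columnHadamard ℓ (R ω)) k ε}ᶜ
    rwa [Set.union_compl_self, probReal_univ] at this
  have hexp : -(1 / 2048 * ε ^ 2 * stableRank X / ((k : ℝ) ^ 2 * τ ^ (4 * ℓ))) = -(Q / 2048) := by
    rw [hQ]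
    ring
  rw [hexp]
  linarith
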